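/- Let $R$ be an associative ring with unity and let $M$ be a left $R$-module. Let $\sigma[M]$ be the full subcategory of $R$-Mod consisting of the modules isomorphic to a submodule of an $M$-generated module (a homomorphic image of a direct sum of copies of $M$); write $\widehat{M}$ for the injective hull of $M$ in $\sigma[M]$. For submodules $K,L\subseteq M$ put $K_ML=\sum\{f(K)\mid f\in \operatorname{Hom}_R(M,L)\}$. A fully invariant submodule $P\neq M$ of $M$ is *prime in $M$* if for all fully invariant $K,L\subseteq M$, $K_ML\subseteq P$ implies $K\subseteq P$ or $L\subseteq P$; a *minimal prime in $M$* is a minimal element, under inclusion, of the set of submodules prime in $M$. $M$ is *semiprime* if $M\ne 0$ and $K_MK=0$ implies $K=0$ for every fully invariant $K\subseteq M$. $M$ is a *Goldie module* if the set of submodules $\bigcap_{f\in X}\ker f$, $X\subseteq \operatorname{End}_R(M)$, satisfies the ascending chain condition and $M$ has finite uniform dimension (it contains no infinite direct sum of nonzero submodules). For a module $N$ put $\operatorname{Ann}_M(N)=\bigcap\{\ker f\mid f\in\operatorname{Hom}_R(M,N)\}$, and for $N\in\sigma[M]$ let $\operatorname{Ass}_M(N)$ be the set of submodules $K$ prime in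 $M$ for which there is a nonzero submodule $L\subseteq N$ with $\operatorname{Ann}_M(L')=K$ for all nonzero submodules $L'\subseteq L$. **Theorem.** Let $M$ be projective in $\sigma[M]$, semiprime and a Goldie module. Then there are only finitely many minimal primes in $M$; and if $P_1,\dots,P_n$ are the (pairwise distinct) minimal primes in $M$, then there exist uniform modules $E_1,\dots,E_n\in\sigma[M]$ that are injective in $\sigma[M]$, and integers $k_1,\dots,k_n\ge 1$, such that $$\widehat{M}\cong E_1^{k_1}\oplus E_2^{k_2}\oplus\cdots\oplus E_n^{k_n}\qquad\text{and}\qquad \operatorname{Ass}_M(E_i)=\{P_i\}\quad (1\le i\le n).$$ -/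

import Mathlib

universe u v w

section SigmaCategory

/-- `G` is `M`-generated: there is an epimorphism from a direct sum of copies of `M` onto `G`. -/
def IsGeneratedBy (R : Type u) [Ring R] (M : Type v) [AddCommGroup M] [Module R M]
    (G : Type v) [AddCommGroup G] [Module R G] : Prop :=
  ∃ (I : Type v) (g : (I →₀ M) →ₗ[R] G), Function.Surjective g

/-- `X` is an object of the category `σ[M]`: it is isomorphic to a submodule of an
`M`-generated module. -/
def InSigma (R : Type u) [Ring R] (M : Type v) [AddCommGroup M] [Module R M]
    (X : Type v) [AddCommGroup X] [Module R X] : Prop :=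
  ∃ (G : Type v) (_ : AddCommGroup G) (_ : Module R G),
    IsGeneratedBy R M G ∧ ∃ f : X →ₗ[R] G, Function.Injective f

/-- `M` is a projective object of `σ[M]`. (The epimorphisms of `σ[M]` are the surjective maps.) -/
def IsProjectiveInSigma (R : Type u) [Ring R] (M : Type v) [AddCommGroup M] [Module R M] : Prop :=
  ∀ (A B : Type v) [AddCommGroup A] [Module R A] [AddCommGroup B] [Module R B],
    InSigma R M A → InSigma R M B →
      ∀ (g : A →ₗ[R] B), Function.Surjective g →
        ∀ f : M →ₗ[R] B, ∃ h : M →ₗ[R] A, g ∘ₗ h = f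

/-- `Q` is an injective object of `σ[M]`. (The monomorphisms of `σ[M]` are the injective maps.) -/
def IsInjectiveInSigma (R : Type u) [Ring R] (M : Type v) [AddCommGroup M] [Module R M]
    (Q : Type v) [AddCommGroup Q] [Module R Q] : Prop :=
  InSigma R M Q ∧
    ∀ (A B : Type v) [AddCommGroup A] [Module R A] [AddCommGroup B] [Module R B],
      InSigma R M A → InSigma R M B →
        ∀ (i : A →ₗ[R] B), Function.Injective i →
          ∀ f : A →ₗ[R] Q, ∃ h : B →ₗ[R] Q, h ∘ₗ i = f

/-- `N` is an essential submodule of `X`. -/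
def IsEssentialSubmodule {R : Type u} [Ring R] {X : Type w} [AddCommGroup X] [Module R X]
    (N : Submodule R X) : Prop :=
  ∀ L : Submodule R X, L ≠ ⊥ → N ⊓ L ≠ ⊥

/-- The embedding `j : X → Q` exhibits `Q` as an injective hull of `X` in `σ[M]`. -/
def IsInjectiveHullInSigma {R : Type u} [Ring R] (M : Type v) [AddCommGroup M] [Module R M]
    {X Q : Type v} [AddCommGroup X] [Module R X] [AddCommGroup Q] [Module R Q]
    (j : X →ₗ[R] Q) : Prop :=
  Function.Injective j ∧ IsEssentialSubmodule (LinearMap.range j) ∧ IsInjectiveInSigma R M Q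

end SigmaCategory

section PrimeSubmodules

/-- The product `K_M L`, the sum of all `f(K)` with `f ∈ Hom_R(M, L)`, as a submodule of `M`. -/
def prodM {R : Type u} [Ring R] {M : Type v} [AddCommGroup M] [Module R M]
    (K L : Submodule R M) : Submodule R M :=
  ⨆ f : M →ₗ[R] L, K.map (L.subtype ∘ₗ f)

/-- `P` is prime in `M`. -/
def IsPrimeIn {R : Type u} [Ring R] {M : Type v} [AddCommGroup M] [Module R M]
    (P : Submodule R M) : Prop :=
  P ≠ ⊤ ∧ P.IsFullyInvariant ∧
    ∀ K L : Submodule R M, K.IsFullyInvariant → L.IsFullyInvariant →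
      prodM K L ≤ P → K ≤ P ∨ L ≤ P

/-- `P` is a minimal prime in `M`: a minimal element, under inclusion, of the set of
submodules prime in `M`. -/
def IsMinimalPrimeIn {R : Type u} [Ring R] {M : Type v} [AddCommGroup M] [Module R M]
    (P : Submodule R M) : Prop :=
  Minimal IsPrimeIn P

/-- `N` is semiprime in `M`. -/
def IsSemiprimeIn {R : Type u} [Ring R] {M : Type v} [AddCommGroup M] [Module R M]
    (N : Submodule R M) : Prop :=
  N ≠ ⊤ ∧ N.IsFullyInvariant ∧
    ∀ K : Submodule R M, K.IsFullyInvariant → prodM K K ≤ N → K ≤ N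

/-- `M` is a semiprime module (in particular `M ≠ 0`). -/
def IsSemiprimeModule (R : Type u) [Ring R] (M : Type v) [AddCommGroup M] [Module R M] : Prop :=
  IsSemiprimeIn (⊥ : Submodule R M)

/-- `Ann_M(X)`, the intersection of the kernels of all homomorphisms `M → X`. -/
def annM (R : Type u) [Ring R] (M : Type v) [AddCommGroup M] [Module R M]
    (X : Type w) [AddCommGroup X] [Module R X] : Submodule R M :=
  ⨅ f : M →ₗ[R] X, LinearMap.ker f

/-- `Ass_M(N)`: the submodules `K` prime in `M` for which there is a nonzero submodule `L` of `N`
with `Ann_M(L') = K` for all nonzero submodules `L'` of `L`. -/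
def assM (R : Type u) [Ring R] (M : Type v) [AddCommGroup M] [Module R M]
    (N : Type w) [AddCommGroup N] [Module R N] : Set (Submodule R M) :=
  {K | IsPrimeIn K ∧ ∃ L : Submodule R N, L ≠ ⊥ ∧
    ∀ L' : Submodule R N, L' ≠ ⊥ → L' ≤ L → annM R M L' = K}

end PrimeSubmodules

section Goldie

/-- `X` is a uniform module: it is nonzero and any two nonzero submodules meet nontrivially. -/
def IsUniformModule (R : Type u) [Ring R] (X : Type w) [AddCommGroup X] [Module R X] : Prop :=
  Nontrivial X ∧ ∀ K L : Submodule R X, K ≠ ⊥ → L ≠ ⊥ → K ⊓ L ≠ ⊥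

/-- The set `𝒜_M` of all submodules `⋂_{f ∈ S} ker f` of `M`, for `S ⊆ End_R(M)`. -/
def annihilatorSet (R : Type u) [Ring R] (M : Type v) [AddCommGroup M] [Module R M] :
    Set (Submodule R M) :=
  {A | ∃ S : Set (Module.End R M), A = ⨅ f ∈ S, LinearMap.ker f}

/-- `M` satisfies the ascending chain condition on annihilators. -/
def HasACCOnAnnihilators (R : Type u) [Ring R] (M : Type v) [AddCommGroup M] [Module R M] : Prop :=
  WellFoundedGT (annihilatorSet R M)

/-- `M` has finite uniform dimension: it contains no infinite direct sum of nonzero submodules. -/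
def HasFiniteUniformDimension (R : Type u) [Ring R] (M : Type v) [AddCommGroup M] [Module R M] :
    Prop :=
  ¬ ∃ N : ℕ → Submodule R M, (∀ i, N i ≠ ⊥) ∧ iSupIndep N

/-- `M` is a Goldie module. -/
def IsGoldieModule (R : Type u) [Ring R] (M : Type v) [AddCommGroup M] [Module R M] : Prop :=
  HasACCOnAnnihilators R M ∧ HasFiniteUniformDimension R M

end Goldie

/-!
The key point is that semiprimeness, a condition on fully invariant submodules, reaches all
submodules when `M` is projective in `σ[M]`: maps from `M` to the fully invariant closure of `N`
lift to direct sums of copies of `N`, so `N` and its closure have the same annihilator, and every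
nonzero `N ≤ M` admits `f : M → N` with `f(N) ≠ 0` (`IsSemiprimeModule.exists_apply_ne_zero`).
Hence, for `A` fully invariant, `A ≤ Ann_M(N)` if and only if `A ∩ N = 0`.

Let `U ≤ M` be uniform. Then every nonzero module embedded in `U` has the annihilator `Ann_M(U)`
(`IsSemiprimeModule.annM_eq_of_injective`), and `Ann_M(U)` is a minimal prime
(`IsSemiprimeModule.isMinimalPrimeIn_annM`). Finite uniform dimension gives an essential direct
sum `U_1 ⊕ ⋯ ⊕ U_m` of uniform submodules. The annihilators of the `U_i` intersect in zero, so they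
are all the minimal primes (`IsSemiprimeModule.exists_eq_annM`).

The hull `Mhat` is the direct sum of maximal essential extensions `F_i` of the `U_i` inside it, each
of which is a uniform injective object of `σ[M]` with `Ann_M(U_i)` as its only associated prime.
The chain condition on annihilators enters to show that `F_i ≅ F_k` when `Ann_M(U_i) = Ann_M(U_k)`:
it produces, for every uniform `W ≤ M`, a map `M → W` that is injective on `W`
(`IsSemiprimeModule.exists_injective_on`), and lifting such a map along a surjection `U → W` with
`W ≤ V` embeds a nonzero part of `V` in `U` (`IsSemiprimeModule.exists_injective_of_annM_eq`).
-/

/-! ### Essential and uniform submodules -/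

section Essential

variable {R : Type u} [Ring R] {X : Type v} [AddCommGroup X] [Module R X]

theorem isEssentialSubmodule_iff {N : Submodule R X} :
    IsEssentialSubmodule N ↔ ∀ x : X, x ≠ 0 → ∃ r : R, r • x ≠ 0 ∧ r • x ∈ N := by
  constructor
  · intro h x hx
    have h1 := h (R ∙ x) (by simpa using hx)
    obtain ⟨y, hy, hy0⟩ := (Submodule.ne_bot_iff _).1 h1
    obtain ⟨r, rfl⟩ := Submodule.mem_span_singleton.1 hy.2
    exact ⟨r, hy0, hy.1⟩
  · intro h L hL
    obtain ⟨x, hx, hx0⟩ := (Submodule.ne_bot_iff _).1 hL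
    obtain ⟨r, hr0, hr⟩ := h x hx0
    exact (Submodule.ne_bot_iff _).2 ⟨r • x, ⟨hr, L.smul_mem r hx⟩, hr0⟩

theorem IsEssentialSubmodule.injective_of_forall_mem {N : Submodule R X}
    (hN : IsEssentialSubmodule N) {Y : Type w} [AddCommGroup Y] [Module R Y] {h : X →ₗ[R] Y}
    (h0 : ∀ x ∈ N, h x = 0 → x = 0) : Function.Injective h := by
  rw [injective_iff_map_eq_zero]
  intro x hx
  by_contra hx0
  obtain ⟨r, hr0, hr⟩ := isEssentialSubmodule_iff.1 hN x hx0
  exact hr0 (h0 _ hr (by rw [map_smul, hx, smul_zero]))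

/-- A nonzero submodule of a uniform module is essential. -/
theorem IsUniformModule.isEssentialSubmodule (hX : IsUniformModule R X) {N : Submodule R X}
    (hN : N ≠ ⊥) : IsEssentialSubmodule N :=
  fun L hL ↦ hX.2 N L hN hL

/-- A module with an essential uniform submodule is uniform. -/
theorem IsUniformModule.of_isEssentialSubmodule_range {Y : Type w} [AddCommGroup Y] [Module R Y]
    (hX : IsUniformModule R X) {u : X →ₗ[R] Y} (hu : Function.Injective u)
    (hess : IsEssentialSubmodule (LinearMap.range u)) : IsUniformModule R Y := by
  have key : ∀ K : Submodule R Y, K ≠ ⊥ → K.comap u ≠ ⊥ := by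
    intro K hK
    obtain ⟨_, ⟨⟨x, rfl⟩, hxK⟩, hx0⟩ := (Submodule.ne_bot_iff _).1 (hess K hK)
    exact (Submodule.ne_bot_iff _).2 ⟨x, hxK, fun h ↦ hx0 (by rw [h, map_zero])⟩
  refine ⟨?_, fun K L hK hL ↦ ?_⟩
  · have := hX.1
    exact hu.nontrivial
  · obtain ⟨x, ⟨hxK, hxL⟩, hx0⟩ := (Submodule.ne_bot_iff _).1 (hX.2 _ _ (key K hK) (key L hL))
    exact (Submodule.ne_bot_iff _).2 ⟨u x, ⟨hxK, hxL⟩, fun h ↦ hx0 (hu (by rw [h, map_zero]))⟩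

/-- Two submodules meeting a uniform submodule `U` nontrivially have a common nonzero element
in `U`. -/
theorem IsUniformModule.inf_inf_ne_bot {U A B : Submodule R X} (hU : IsUniformModule R U)
    (hA : A ⊓ U ≠ ⊥) (hB : B ⊓ U ≠ ⊥) : A ⊓ B ⊓ U ≠ ⊥ := by
  have key : ∀ K : Submodule R X, K ⊓ U ≠ ⊥ → K.comap U.subtype ≠ ⊥ := by
    intro K hK
    obtain ⟨x, ⟨hxK, hxU⟩, hx0⟩ := (Submodule.ne_bot_iff _).1 hK
    exact (Submodule.ne_bot_iff _).2 ⟨⟨x, hxU⟩, hxK, fun h ↦ hx0 (congrArg Subtype.val h)⟩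
  obtain ⟨x, ⟨hxA, hxB⟩, hx0⟩ := (Submodule.ne_bot_iff _).1 (hU.2 _ _ (key A hA) (key B hB))
  exact (Submodule.ne_bot_iff _).2 ⟨x, ⟨⟨hxA, hxB⟩, x.2⟩, fun h ↦ hx0 (Subtype.ext h)⟩

/-- Finite products of essential extensions are essential: a nonzero element of the product has
a nonzero multiple with all its components in the given submodules. -/
theorem exists_smul_ne_zero_forall_mem {ι : Type*} [Finite ι] {E : ι → Type*}
    [∀ i, AddCommGroup (E i)] [∀ i, Module R (E i)] (N : ∀ i, Submodule R (E i))
    (hN : ∀ i, ∀ x : E i, x ≠ 0 → ∃ r : R, r • x ≠ 0 ∧ r • x ∈ N i)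
    (x : ∀ i, E i) (hx : x ≠ 0) : ∃ r : R, r • x ≠ 0 ∧ ∀ i, r • x i ∈ N i := by
  classical
  cases nonempty_fintype ι
  suffices ∀ s : Finset ι, ∃ r : R, r • x ≠ 0 ∧ ∀ i ∈ s, r • x i ∈ N i by
    obtain ⟨r, hr, h⟩ := this Finset.univ
    exact ⟨r, hr, fun i ↦ h i (Finset.mem_univ i)⟩
  intro s
  induction s using Finset.induction_on with
  | empty => exact ⟨1, by simpa using hx, by simp⟩
  | insert i s _ ih =>
    obtain ⟨r, hr, h⟩ := ih
    by_cases h0 : r • x i = 0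
    · refine ⟨r, hr, fun j hj ↦ ?_⟩
      rcases Finset.mem_insert.1 hj with rfl | hj
      · rw [h0]; exact zero_mem _
      · exact h j hj
    · obtain ⟨t, ht0, ht⟩ := hN i _ h0
      refine ⟨t * r, fun h ↦ ht0 ?_, fun j hj ↦ ?_⟩
      · rw [← mul_smul]; exact congrFun h i
      · rw [mul_smul]
        rcases Finset.mem_insert.1 hj with rfl | hj
        · exact ht
        · exact (N j).smul_mem t (h j hj)

/-- A sequence `A` is independent if each `A n` misses a submodule `L (n + 1)` containing all
later members of the sequence. -/
theorem iSupIndep_of_antitone_of_disjoint {A L : ℕ → Submodule R X} (hL : Antitone L)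
    (hA : ∀ n, A n ≤ L n) (hd : ∀ n, Disjoint (A n) (L (n + 1))) : iSupIndep A := by
  rw [iSupIndep_iff_finsetSum_eq_zero_imp_eq_zero]
  intro s v
  induction s using Finset.induction_on_min with
  | empty => simp
  | insert a s has ih =>
    intro hv hsum
    rw [Finset.sum_insert (fun h ↦ lt_irrefl _ (has a h))] at hsum
    have h1 : ∑ i ∈ s, v i ∈ L (a + 1) := Submodule.sum_mem _ fun i hi ↦
      hL (has i hi) (hA i (hv i (Finset.mem_insert_of_mem hi)))
    have h2 : v a = 0 := by
      refine Submodule.disjoint_def.1 (hd a) _ (hv a (Finset.mem_insert_self a s)) ?_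
      rw [eq_neg_of_add_eq_zero_left hsum]
      exact neg_mem h1
    rw [h2, zero_add] at hsum
    intro i hi
    rcases Finset.mem_insert.1 hi with rfl | hi
    · exact h2
    · exact ih (fun i hi ↦ hv i (Finset.mem_insert_of_mem hi)) hsum i hi

theorem HasFiniteUniformDimension.exists_isUniformModule_le (h : HasFiniteUniformDimension R X)
    {N : Submodule R X} (hN : N ≠ ⊥) : ∃ U ≤ N, IsUniformModule R U := by
  by_contra! hcon
  have step : ∀ L : {L : Submodule R X // L ≤ N ∧ L ≠ ⊥},
      ∃ (A : Submodule R X) (L' : {L : Submodule R X // L ≤ N ∧ L ≠ ⊥}),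
        A ≠ ⊥ ∧ A ≤ L ∧ L'.1 ≤ L ∧ Disjoint A L' := by
    rintro ⟨L, hLN, hL⟩
    have h1 := hcon L hLN
    have : Nontrivial L := Submodule.nontrivial_iff_ne_bot.2 hL
    simp only [IsUniformModule, this, true_and, not_forall] at h1
    obtain ⟨K, K', hK, hK', hKK⟩ := h1
    push Not at hKK
    have inj := Submodule.map_injective_of_injective L.injective_subtype
    refine ⟨K.map L.subtype, ⟨K'.map L.subtype, (Submodule.map_subtype_le _ _).trans hLN, ?_⟩,
      ?_, Submodule.map_subtype_le _ _, Submodule.map_subtype_le _ _, ?_⟩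
    · exact fun h ↦ hK' (inj (by simpa using h))
    · exact fun h ↦ hK (inj (by simpa using h))
    · rw [disjoint_iff, ← Submodule.map_inf _ L.injective_subtype, hKK, Submodule.map_bot]
  choose A T hA hAL hT hd using step
  let L : ℕ → {L : Submodule R X // L ≤ N ∧ L ≠ ⊥} := fun n ↦ T^[n] ⟨N, le_rfl, hN⟩
  have hL : ∀ n, L (n + 1) = T (L n) := fun n ↦ Function.iterate_succ_apply' _ _ _
  refine h ⟨fun n ↦ A (L n), fun n ↦ hA _, iSupIndep_of_antitone_of_disjoint
    (L := fun n ↦ (L n).1) (antitone_nat_of_succ_le fun n ↦ ?_) (fun n ↦ hAL _) fun n ↦ ?_⟩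
  · rw [hL]; exact hT _
  · rw [hL]; exact hd _

theorem sSupIndep.insert_of_disjoint {s : Set (Submodule R X)} (hs : sSupIndep s)
    {U : Submodule R X} (hU : Disjoint (sSup s) U) : sSupIndep (insert U s) := by
  rintro a (rfl | ha)
  · refine hU.symm.mono_right (sSup_le_sSup ?_)
    rintro b ⟨rfl | hb, hba⟩
    · exact absurd rfl hba
    · exact hb
  · have h1 : Disjoint a (sSup (s \ {a}) ⊔ U) :=
      (hs ha).disjoint_sup_right_of_disjoint_sup_left
        (hU.mono_left (sup_le (le_sSup ha) (sSup_le_sSup Set.sdiff_subset)))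
    refine h1.mono_right (sSup_le ?_)
    rintro b ⟨rfl | hb, hba⟩
    · exact le_sup_right
    · exact (le_sSup (show b ∈ s \ {a} from ⟨hb, hba⟩)).trans le_sup_left

/-- A module of finite uniform dimension has an essential submodule that is a finite direct sum
of uniform submodules. -/
theorem HasFiniteUniformDimension.exists_iSupIndep_isUniformModule
    (h : HasFiniteUniformDimension R X) :
    ∃ s : Set (Submodule R X), s.Finite ∧ (∀ U ∈ s, IsUniformModule R U) ∧
      iSupIndep (fun U : s ↦ (U : Submodule R X)) ∧
      IsEssentialSubmodule (⨆ U : s, (U : Submodule R X)) := by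
  obtain ⟨s, hs⟩ := zorn_subset
    {s : Set (Submodule R X) | sSupIndep s ∧ ∀ U ∈ s, IsUniformModule R U} (by
      intro c hc hchain
      refine ⟨⋃₀ c, ⟨?_, ?_⟩, fun t ht ↦ Set.subset_sUnion_of_mem ht⟩
      · rw [Set.sUnion_eq_iUnion]
        exact sSupIndep_iUnion_of_directed hchain.directed (fun t ↦ (hc t.2).1)
      · rintro U ⟨t, ht, hU⟩
        exact (hc ht).2 U hU)
  have hind : iSupIndep (fun U : s ↦ (U : Submodule R X)) := (sSupIndep_iff s).1 hs.prop.1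
  have hbot : ∀ U ∈ s, U ≠ ⊥ := fun U hU ↦
    Submodule.nontrivial_iff_ne_bot.1 (hs.prop.2 U hU).1
  refine ⟨s, ?_, hs.prop.2, hind, ?_⟩
  · by_contra hinf
    have : Infinite s := Set.infinite_coe_iff.2 hinf
    let e := Infinite.natEmbedding s
    exact h ⟨fun n ↦ (e n : Submodule R X), fun n ↦ hbot _ (e n).2, hind.comp e.injective⟩
  · intro L hL hinf
    rw [← sSup_eq_iSup'] at hinf
    obtain ⟨U, hUL, hU⟩ := h.exists_isUniformModule_le hL
    have hd : Disjoint (sSup s) U := (disjoint_iff.2 hinf).mono_right hUL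
    have hmem : U ∈ s := hs.le_of_ge (y := insert U s)
      ⟨hs.prop.1.insert_of_disjoint hd, by
        rintro V (rfl | hV)
        · exact hU
        · exact hs.prop.2 V hV⟩ (Set.subset_insert U s) (Set.mem_insert U s)
    exact hbot U hmem (disjoint_self.1 (hd.mono_left (le_sSup hmem)))

end Essential

/-! ### The category `σ[M]` and injective objects -/

section Sigma

variable {R : Type u} [Ring R] {M : Type v} [AddCommGroup M] [Module R M]

theorem inSigma_finsupp (I : Type v) : InSigma R M (I →₀ M) :=
  ⟨I →₀ M, inferInstance, inferInstance, ⟨I, LinearMap.id, Function.surjective_id⟩,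
    LinearMap.id, Function.injective_id⟩

theorem InSigma.of_injective {A B : Type v} [AddCommGroup A] [Module R A] [AddCommGroup B]
    [Module R B] (hB : InSigma R M B) (f : A →ₗ[R] B) (hf : Function.Injective f) :
    InSigma R M A := by
  obtain ⟨G, _, _, hG, g, hg⟩ := hB
  exact ⟨G, _, _, hG, g ∘ₗ f, hg.comp hf⟩

theorem inSigma_self : InSigma R M M :=
  (inSigma_finsupp PUnit).of_injective (Finsupp.lsingle PUnit.unit)
    (Finsupp.single_injective _)

theorem inSigma_submodule (N : Submodule R M) : InSigma R M N :=
  inSigma_self.of_injective N.subtype N.injective_subtype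

theorem inSigma_finsupp_submodule (I : Type v) (N : Submodule R M) : InSigma R M (I →₀ N) :=
  (inSigma_finsupp I).of_injective (Finsupp.mapRange.linearMap N.subtype)
    (Finsupp.mapRange_injective _ (map_zero _) N.injective_subtype)

theorem InSigma.quotient {A : Type v} [AddCommGroup A] [Module R A] (hA : InSigma R M A)
    (C : Submodule R A) : InSigma R M (A ⧸ C) := by
  obtain ⟨G, _, _, ⟨I, p, hp⟩, g, hg⟩ := hA
  refine ⟨G ⧸ C.map g, inferInstance, inferInstance,
    ⟨I, (C.map g).mkQ ∘ₗ p, (Submodule.mkQ_surjective _).comp hp⟩,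
    C.mapQ (C.map g) g (Submodule.le_comap_map _ _), ?_⟩
  rw [← LinearMap.ker_eq_bot, Submodule.ker_mapQ, Submodule.comap_map_eq_of_injective hg,
    Submodule.mkQ_map_self]

/-- The element-wise form of "`E` is an essential extension of `U`", for submodules of a common
module; `U ≤ E` is not part of it. -/
def IsEssentialIn {X : Type v} [AddCommGroup X] [Module R X] (U E : Submodule R X) : Prop :=
  ∀ x ∈ E, x ≠ 0 → ∃ r : R, r • x ≠ 0 ∧ r • x ∈ U

/-- Inside an injective object `Q` of `σ[M]`, every submodule `U` has an essential extension `E`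
which is a direct summand of `Q`: any maximal essential extension of `U` in `Q` will do. -/
theorem IsInjectiveInSigma.exists_essential_retract {Q : Type v} [AddCommGroup Q] [Module R Q]
    (hQ : IsInjectiveInSigma R M Q) (U : Submodule R Q) :
    ∃ E : Submodule R Q, U ≤ E ∧ IsEssentialIn U E ∧ ∃ p : Q →ₗ[R] E, ∀ x : E, p x = x := by
  obtain ⟨E, hUE, hE⟩ := zorn_le_nonempty₀ {E : Submodule R Q | IsEssentialIn U E} (by
    intro c hc hchain y hy
    refine ⟨sSup c, ?_, fun z hz ↦ le_sSup hz⟩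
    intro x hx
    obtain ⟨F, hF, hxF⟩ := (Submodule.mem_sSup_of_directed ⟨y, hy⟩ hchain.directedOn).1 hx
    exact hc hF x hxF) U (fun x hx hx0 ↦ ⟨1, by simpa using hx0, by simpa using hx⟩)
  obtain ⟨C, -, hC⟩ := zorn_le_nonempty₀ {C : Submodule R Q | Disjoint E C} (by
    intro c hc hchain y hy
    refine ⟨sSup c, ?_, fun z hz ↦ le_sSup hz⟩
    rw [Set.mem_ofPred_eq, Submodule.disjoint_def]
    intro x hxE hx
    obtain ⟨F, hF, hxF⟩ := (Submodule.mem_sSup_of_directed ⟨y, hy⟩ hchain.directedOn).1 hx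
    exact Submodule.disjoint_def.1 (hc hF) x hxE hxF) ⊥ disjoint_bot_right
  have hEC : Disjoint E C := hC.prop
  -- Since `C` is a maximal complement of `E`, the image of `E` in `Q ⧸ C` is essential.
  have hess : ∀ y : Q ⧸ C, y ≠ 0 → ∃ (r : R) (e : Q), e ∈ E ∧ e ≠ 0 ∧ r • y = C.mkQ e := by
    intro y hy
    obtain ⟨z, rfl⟩ := C.mkQ_surjective y
    have hz : z ∉ C := fun h ↦ hy ((Submodule.Quotient.mk_eq_zero C).2 h)
    have hnd : ¬ Disjoint E (C ⊔ R ∙ z) := fun h ↦ hz <|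
      hC.le_of_ge h le_sup_left (Submodule.mem_sup_right (Submodule.mem_span_singleton_self z))
    rw [Submodule.disjoint_def] at hnd
    push Not at hnd
    obtain ⟨e, heE, he, he0⟩ := hnd
    obtain ⟨c, hc, w, hw, rfl⟩ := Submodule.mem_sup.1 he
    obtain ⟨r, rfl⟩ := Submodule.mem_span_singleton.1 hw
    refine ⟨r, _, heE, he0, ?_⟩
    rw [map_add, map_smul, Submodule.mkQ_apply C c, (Submodule.Quotient.mk_eq_zero C).2 hc,
      zero_add]
  obtain ⟨h, hh⟩ := hQ.2 E (Q ⧸ C) (hQ.1.of_injective E.subtype E.injective_subtype)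
    (hQ.1.quotient C) (C.mkQ ∘ₗ E.subtype) (by
      rw [injective_iff_map_eq_zero]
      intro x hx
      exact Subtype.ext (Submodule.disjoint_def.1 hEC x x.2
        ((Submodule.Quotient.mk_eq_zero C).1 hx))) E.subtype
  have hh' : ∀ e ∈ E, h (C.mkQ e) = e := fun e he ↦ LinearMap.congr_fun hh ⟨e, he⟩
  have hrange : LinearMap.range h ≤ E := by
    refine hE.le_of_ge (y := LinearMap.range h) ?_ (fun e he ↦ ⟨_, hh' e he⟩)
    rintro _ ⟨y, rfl⟩ hy0
    obtain ⟨r, e, he, he0, hre⟩ := hess y (fun h0 ↦ hy0 (by rw [h0, map_zero]))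
    obtain ⟨t, ht0, ht⟩ := hE.prop e he he0
    have : (t * r) • h y = t • e := by rw [mul_smul, ← map_smul, hre, hh' e he]
    exact ⟨t * r, this ▸ ht0, this ▸ ht⟩
  exact ⟨E, hUE, hE.prop, (h ∘ₗ C.mkQ).codRestrict E (fun x ↦ hrange ⟨_, rfl⟩),
    fun x ↦ Subtype.ext (hh' x x.2)⟩

theorem IsInjectiveInSigma.of_retract {Q : Type v} [AddCommGroup Q] [Module R Q]
    (hQ : IsInjectiveInSigma R M Q) {E : Submodule R Q} (p : Q →ₗ[R] E) (hp : ∀ x : E, p x = x) :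
    IsInjectiveInSigma R M E := by
  refine ⟨hQ.1.of_injective E.subtype E.injective_subtype, ?_⟩
  intro A B _ _ _ _ hA hB i hi f
  obtain ⟨h, hh⟩ := hQ.2 A B hA hB i hi (E.subtype ∘ₗ f)
  refine ⟨p ∘ₗ h, LinearMap.ext fun a ↦ ?_⟩
  have := LinearMap.congr_fun hh a
  simp only [LinearMap.comp_apply, Submodule.subtype_apply] at this ⊢
  rw [this, hp]

/-- A split injection with essential range is an isomorphism, as the kernel of a left inverse
misses its range. -/
theorem nonempty_linearEquiv_of_leftInverse {A B : Type v} [AddCommGroup A] [Module R A]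
    [AddCommGroup B] [Module R B] {f : A →ₗ[R] B} (hess : IsEssentialSubmodule (LinearMap.range f))
    {g : B →ₗ[R] A} (hgf : g ∘ₗ f = LinearMap.id) : Nonempty (B ≃ₗ[R] A) := by
  have hgf' : ∀ a, g (f a) = a := LinearMap.congr_fun hgf
  refine ⟨LinearEquiv.ofBijective g ⟨hess.injective_of_forall_mem ?_, fun a ↦ ⟨_, hgf' a⟩⟩⟩
  rintro _ ⟨a, rfl⟩ ha
  rw [hgf'] at ha
  rw [ha, map_zero]

/-- Uniform injective objects of `σ[M]` are isomorphic as soon as a nonzero submodule of one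
embeds into the other. -/
theorem IsInjectiveInSigma.nonempty_linearEquiv_of_isUniformModule {E F W : Type v}
    [AddCommGroup E] [Module R E] [AddCommGroup F] [Module R F] [AddCommGroup W] [Module R W]
    [Nontrivial W]
    (hE : IsInjectiveInSigma R M E) (hF : IsInjectiveInSigma R M F) (hEu : IsUniformModule R E)
    (hFu : IsUniformModule R F) (a : W →ₗ[R] E) (ha : Function.Injective a)
    (b : W →ₗ[R] F) (hb : Function.Injective b) : Nonempty (F ≃ₗ[R] E) := by
  have range_ne_bot : ∀ {Y Z : Type v} [AddCommGroup Y] [Module R Y] [AddCommGroup Z]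
      [Module R Z] [Nontrivial Y] (f : Y →ₗ[R] Z), Function.Injective f →
      LinearMap.range f ≠ ⊥ := by
    intro Y Z _ _ _ _ _ f hf h
    obtain ⟨y, hy⟩ := exists_ne (0 : Y)
    exact hy (hf (by rw [LinearMap.range_eq_bot.1 h, LinearMap.zero_apply, LinearMap.zero_apply]))
  obtain ⟨h, hh⟩ := hF.2 W E (hE.1.of_injective a ha) hE.1 a ha b
  have hinj : Function.Injective h := by
    refine (hEu.isEssentialSubmodule (range_ne_bot a ha)).injective_of_forall_mem ?_
    rintro _ ⟨x, rfl⟩ hx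
    have : b x = 0 := by rw [← hh]; exact hx
    rw [hb (this.trans (map_zero b).symm), map_zero]
  have := hEu.1
  obtain ⟨g, hg⟩ := hE.2 E F hE.1 hF.1 h hinj LinearMap.id
  exact nonempty_linearEquiv_of_leftInverse
    (hFu.isEssentialSubmodule (range_ne_bot h hinj)) hg

/-- If an injective object `Q` of `σ[M]` has an essential finite direct sum of submodules `U i`,
then it is the direct sum of any injective essential extensions `E i` of the `U i` inside `Q`. -/
theorem IsInjectiveInSigma.nonempty_linearEquiv_pi {Q : Type v} [AddCommGroup Q] [Module R Q]
    (hQ : IsInjectiveInSigma R M Q) {ι : Type v} [Finite ι] {U E : ι → Submodule R Q}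
    (hind : iSupIndep U) (hess : IsEssentialSubmodule (⨆ i, U i)) (hUE : ∀ i, U i ≤ E i)
    (hE : ∀ i, IsEssentialIn (U i) (E i)) (hEinj : ∀ i, IsInjectiveInSigma R M (E i)) :
    Nonempty (Q ≃ₗ[R] (∀ i, E i)) := by
  classical
  cases nonempty_fintype ι
  let Φ : (∀ i, E i) →ₗ[R] Q := ∑ i, (E i).subtype ∘ₗ LinearMap.proj i
  have hΦ : ∀ x, Φ x = ∑ i, (x i : Q) := fun x ↦ by simp [Φ]
  have hinj : Function.Injective Φ := by
    rw [injective_iff_map_eq_zero]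
    intro x hx
    by_contra hx0
    obtain ⟨r, hr0, hr⟩ := exists_smul_ne_zero_forall_mem
      (fun i ↦ (U i).comap (E i).subtype) (fun i x hx ↦ by
        obtain ⟨r, hr0, hr⟩ := hE i x x.2 (fun h ↦ hx (Subtype.ext h))
        exact ⟨r, fun h ↦ hr0 (congrArg Subtype.val h), hr⟩) x hx0
    refine hr0 (funext fun i ↦ Subtype.ext ?_)
    refine (iSupIndep_iff_finsetSum_eq_zero_imp_eq_zero U).1 hind Finset.univ
      (fun i ↦ r • (x i : Q)) (fun i _ ↦ hr i) ?_ i (Finset.mem_univ i)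
    rw [← Finset.smul_sum, ← hΦ, hx, smul_zero]
  have hle : ⨆ i, U i ≤ LinearMap.range Φ := by
    refine iSup_le fun i x hx ↦ ⟨Pi.single i ⟨x, hUE i hx⟩, ?_⟩
    rw [hΦ, Finset.sum_eq_single i]
    · simp
    · intro j _ hj
      simp [Pi.single_eq_of_ne hj]
    · simp
  have hess' : IsEssentialSubmodule (LinearMap.range Φ) := fun L hL h ↦
    hess L hL (le_bot_iff.1 (h ▸ inf_le_inf_right L hle))
  choose g hg using fun i ↦ (hEinj i).2 (∀ i, E i) Q (hQ.1.of_injective Φ hinj) hQ.1 Φ hinj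
    (LinearMap.proj i)
  refine nonempty_linearEquiv_of_leftInverse hess' (g := LinearMap.pi g) ?_
  refine LinearMap.ext fun x ↦ funext fun i ↦ ?_
  exact LinearMap.congr_fun (hg i) x

end Sigma

/-! ### Annihilators and fully invariant submodules -/

section Annihilator

variable {R : Type u} [Ring R] {M : Type v} [AddCommGroup M] [Module R M]

theorem mem_annM {X : Type w} [AddCommGroup X] [Module R X] {x : M} :
    x ∈ annM R M X ↔ ∀ f : M →ₗ[R] X, f x = 0 := by
  simp [annM]

theorem isFullyInvariant_annM (X : Type w) [AddCommGroup X] [Module R X] :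
    (annM R M X).IsFullyInvariant :=
  fun g _ hx ↦ mem_annM.2 fun f ↦ mem_annM.1 hx (f ∘ₗ g)

theorem annM_le_of_injective {X Y : Type*} [AddCommGroup X] [Module R X] [AddCommGroup Y]
    [Module R Y] (f : X →ₗ[R] Y) (hf : Function.Injective f) : annM R M Y ≤ annM R M X :=
  fun _ hx ↦ mem_annM.2 fun g ↦ hf (by rw [map_zero]; exact mem_annM.1 hx (f ∘ₗ g))

/-- Over `M` projective in `σ[M]`, maps from `M` to a quotient of `A` lift to `A`. -/
theorem IsProjectiveInSigma.annM_le_of_surjective (hproj : IsProjectiveInSigma R M)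
    {A B : Type v} [AddCommGroup A] [Module R A] [AddCommGroup B] [Module R B]
    (hA : InSigma R M A) (hB : InSigma R M B) (p : A →ₗ[R] B) (hp : Function.Surjective p) :
    annM R M A ≤ annM R M B := by
  refine fun x hx ↦ mem_annM.2 fun f ↦ ?_
  obtain ⟨h, rfl⟩ := hproj A B hA hB p hp f
  rw [LinearMap.comp_apply, mem_annM.1 hx h, map_zero]

theorem annM_le_annM_finsupp (I : Type v) (N : Submodule R M) :
    annM R M N ≤ annM R M (I →₀ N) :=
  fun _ hx ↦ mem_annM.2 fun f ↦ Finsupp.ext fun i ↦ mem_annM.1 hx (Finsupp.lapply i ∘ₗ f)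

theorem prodM_le_iff {K L X : Submodule R M} :
    prodM K L ≤ X ↔ ∀ f : M →ₗ[R] L, ∀ x ∈ K, (f x : M) ∈ X := by
  simp only [prodM, iSup_le_iff, Submodule.map_le_iff_le_comap]
  exact Iff.rfl

/-- The smallest fully invariant submodule containing `N`: the sum of its images under all
endomorphisms of `M`. -/
def fullyInvariantClosure (N : Submodule R M) : Submodule R M :=
  ⨆ g : Module.End R M, N.map g

theorem le_fullyInvariantClosure (N : Submodule R M) : N ≤ fullyInvariantClosure N := by
  have := le_iSup (fun g : Module.End R M ↦ N.map g) LinearMap.id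
  rwa [Submodule.map_id] at this

theorem isFullyInvariant_fullyInvariantClosure (N : Submodule R M) :
    (fullyInvariantClosure N).IsFullyInvariant := by
  intro f
  refine iSup_le fun g ↦ ?_
  rw [← Submodule.map_le_iff_le_comap, ← Submodule.map_comp]
  exact le_iSup (fun g : Module.End R M ↦ N.map g) (f ∘ₗ g)

theorem fullyInvariantClosure_le_iff {N X : Submodule R M} :
    fullyInvariantClosure N ≤ X ↔ ∀ g : Module.End R M, ∀ x ∈ N, g x ∈ X := by
  simp only [fullyInvariantClosure, iSup_le_iff, Submodule.map_le_iff_le_comap]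
  exact Iff.rfl

/-- The fully invariant closure of `N` is a quotient of a direct sum of copies of `N`. -/
theorem IsProjectiveInSigma.annM_le_annM_fullyInvariantClosure (hproj : IsProjectiveInSigma R M)
    (N : Submodule R M) : annM R M N ≤ annM R M (fullyInvariantClosure N) := by
  let p : (Module.End R M →₀ N) →ₗ[R] M :=
    Finsupp.lsum ℕ fun g : Module.End R M ↦ g ∘ₗ N.subtype
  have hp : LinearMap.range p = fullyInvariantClosure N := by
    refine le_antisymm ?_ (iSup_le fun g ↦ ?_)
    · rintro _ ⟨v, rfl⟩
      rw [Finsupp.lsum_apply, Finsupp.sum]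
      exact Submodule.sum_mem _ fun g _ ↦
        le_iSup (fun g : Module.End R M ↦ N.map g) g (Submodule.mem_map_of_mem (v g).2)
    · rintro _ ⟨x, hx, rfl⟩
      exact ⟨Finsupp.single g ⟨x, hx⟩, by simp [p]⟩
  refine (annM_le_annM_finsupp (Module.End R M) N).trans ?_
  rw [← hp]
  exact hproj.annM_le_of_surjective (inSigma_finsupp_submodule _ N) (inSigma_submodule _)
    p.rangeRestrict p.surjective_rangeRestrict

theorem Submodule.IsFullyInvariant.le_annM_of_inf_eq_bot {A N : Submodule R M}
    (hA : A.IsFullyInvariant) (h : A ⊓ N = ⊥) : A ≤ annM R M N := by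
  refine fun x hx ↦ mem_annM.2 fun f ↦ Subtype.ext ?_
  have : (f x : M) ∈ A ⊓ N := ⟨hA (N.subtype ∘ₗ f) hx, (f x).2⟩
  rwa [h, Submodule.mem_bot] at this

end Annihilator

/-! ### Semiprime projective modules -/

section Semiprime

variable {R : Type u} [Ring R] {M : Type v} [AddCommGroup M] [Module R M]

/-- Semiprimeness, which speaks of fully invariant submodules, passes to all submodules:
`N_M N ≠ 0` for every nonzero `N`, because `N` and its fully invariant closure have the same
annihilator in `M`. -/
theorem IsSemiprimeModule.exists_apply_ne_zero (hsemi : IsSemiprimeModule R M)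
    (hproj : IsProjectiveInSigma R M) {N : Submodule R M} (hN : N ≠ ⊥) :
    ∃ f : M →ₗ[R] N, ∃ x ∈ N, f x ≠ 0 := by
  by_contra! hcon
  refine hN (le_bot_iff.1 ((le_fullyInvariantClosure N).trans
    (hsemi.2.2 _ (isFullyInvariant_fullyInvariantClosure N) (prodM_le_iff.2 fun f x hx ↦ ?_))))
  have h1 : fullyInvariantClosure N ≤ annM R M N :=
    fullyInvariantClosure_le_iff.2 fun g y hy ↦
      isFullyInvariant_annM N g (mem_annM.2 fun f ↦ hcon f y hy)
  rw [mem_annM.1 (hproj.annM_le_annM_fullyInvariantClosure N (h1 hx)) f]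
  exact zero_mem _

theorem IsSemiprimeModule.eq_bot_of_le_annM (hsemi : IsSemiprimeModule R M)
    (hproj : IsProjectiveInSigma R M) {N : Submodule R M} (h : N ≤ annM R M N) : N = ⊥ := by
  by_contra hN
  obtain ⟨f, x, hx, hfx⟩ := hsemi.exists_apply_ne_zero hproj hN
  exact hfx (mem_annM.1 (h hx) f)

theorem IsSemiprimeModule.annM_inf_eq_bot (hsemi : IsSemiprimeModule R M)
    (hproj : IsProjectiveInSigma R M) (N : Submodule R M) : annM R M N ⊓ N = ⊥ :=
  hsemi.eq_bot_of_le_annM hproj (inf_le_left.trans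
    (annM_le_of_injective (Submodule.inclusion inf_le_right) (Submodule.inclusion_injective _)))

/-- All modules embedded in a uniform submodule `U` of `M` have the annihilator of `U`, since a
fully invariant submodule that misses a nonzero part of `U` misses `U`. -/
theorem IsSemiprimeModule.annM_eq_of_injective (hsemi : IsSemiprimeModule R M)
    (hproj : IsProjectiveInSigma R M) {U : Submodule R M} (hU : IsUniformModule R U)
    {X : Type v} [AddCommGroup X] [Module R X] [Nontrivial X] (f : X →ₗ[R] U)
    (hf : Function.Injective f) : annM R M X = annM R M U := by
  refine le_antisymm ?_ (annM_le_of_injective f hf)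
  refine (isFullyInvariant_annM X).le_annM_of_inf_eq_bot ?_
  let g : X →ₗ[R] M := U.subtype ∘ₗ f
  have hg : Function.Injective g := U.injective_subtype.comp hf
  by_contra hne
  have hgU : LinearMap.range g ⊓ U ≠ ⊥ := by
    obtain ⟨x, hx⟩ := exists_ne (0 : X)
    exact (Submodule.ne_bot_iff _).2 ⟨g x, ⟨⟨x, rfl⟩, (f x).2⟩, fun h ↦ hx (hg (by
      rw [h, map_zero]))⟩
  refine hU.inf_inf_ne_bot hne hgU (le_bot_iff.1 (inf_le_left.trans (le_bot_iff.2 ?_)))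
  have h1 := hsemi.annM_inf_eq_bot hproj (LinearMap.range g)
  exact le_bot_iff.1 (h1 ▸ inf_le_inf_right _
    (annM_le_of_injective (LinearEquiv.ofInjective g hg).symm.toLinearMap
      (LinearEquiv.ofInjective g hg).symm.injective))

theorem IsSemiprimeModule.isPrimeIn_annM (hsemi : IsSemiprimeModule R M)
    (hproj : IsProjectiveInSigma R M) {U : Submodule R M} (hU : IsUniformModule R U) :
    IsPrimeIn (annM R M U) := by
  have hU0 : U ≠ ⊥ := Submodule.nontrivial_iff_ne_bot.1 hU.1
  refine ⟨fun h ↦ hU0 (hsemi.eq_bot_of_le_annM hproj (h ▸ le_top)), isFullyInvariant_annM U, ?_⟩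
  intro K L hK hL hKL
  by_contra! hcon
  have hK' : K ⊓ U ≠ ⊥ := fun h ↦ hcon.1 (hK.le_annM_of_inf_eq_bot h)
  have hL' : L ⊓ U ≠ ⊥ := fun h ↦ hcon.2 (hL.le_annM_of_inf_eq_bot h)
  -- `N_M N` is nonzero for `N = K ∩ L ∩ U`, but it lies in `Ann_M(U) ∩ U = 0`.
  obtain ⟨f, x, hx, hfx⟩ := hsemi.exists_apply_ne_zero hproj (hU.inf_inf_ne_bot hK' hL')
  have h1 : (f x : M) ∈ annM R M U ⊓ U :=
    ⟨prodM_le_iff.1 hKL (Submodule.inclusion (inf_le_left.trans inf_le_right) ∘ₗ f) x hx.1.1,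
      (f x).2.2⟩
  rw [hsemi.annM_inf_eq_bot hproj, Submodule.mem_bot] at h1
  exact hfx (Subtype.ext h1)

theorem IsSemiprimeModule.isMinimalPrimeIn_annM (hsemi : IsSemiprimeModule R M)
    (hproj : IsProjectiveInSigma R M) {U : Submodule R M} (hU : IsUniformModule R U) :
    IsMinimalPrimeIn (annM R M U) := by
  refine ⟨hsemi.isPrimeIn_annM hproj hU, fun Q hQ hle ↦ ?_⟩
  rcases hQ.2.2 _ _ (isFullyInvariant_annM U) (isFullyInvariant_fullyInvariantClosure U)
    (prodM_le_iff.2 fun f x hx ↦ by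
      rw [mem_annM.1 (hproj.annM_le_annM_fullyInvariantClosure U hx) f]
      exact zero_mem Q) with h | h
  · exact h
  · exact absurd (hsemi.eq_bot_of_le_annM hproj ((le_fullyInvariantClosure U).trans (h.trans hle)))
      (Submodule.nontrivial_iff_ne_bot.1 hU.1)

/-- A uniform module `E` that contains a copy of a uniform submodule `U` of `M` has
`Ann_M(U)` as its only associated prime. -/
theorem IsSemiprimeModule.assM_eq_singleton (hsemi : IsSemiprimeModule R M)
    (hproj : IsProjectiveInSigma R M) {U : Submodule R M} (hU : IsUniformModule R U)
    {E : Type v} [AddCommGroup E] [Module R E] (hE : IsUniformModule R E) (u : U →ₗ[R] E)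
    (hu : Function.Injective u) : assM R M E = {annM R M U} := by
  have hrange : LinearMap.range u ≠ ⊥ := by
    have := hU.1
    exact Submodule.nontrivial_iff_ne_bot.1 (LinearEquiv.ofInjective u hu).symm.nontrivial
  have key : ∀ L : Submodule R E, L ≠ ⊥ → L ≤ LinearMap.range u → annM R M L = annM R M U := by
    intro L hL hLu
    have := Submodule.nontrivial_iff_ne_bot.2 hL
    exact hsemi.annM_eq_of_injective hproj hU
      ((LinearEquiv.ofInjective u hu).symm.toLinearMap ∘ₗ Submodule.inclusion hLu)
      ((LinearEquiv.ofInjective u hu).symm.injective.comp (Submodule.inclusion_injective _))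
  refine Set.Subset.antisymm ?_ ?_
  · rintro K ⟨-, L, hL, hLK⟩
    have hne := hE.2 L _ hL hrange
    exact (hLK _ hne inf_le_left).symm.trans (key _ hne inf_le_right)
  · rintro _ rfl
    exact ⟨hsemi.isPrimeIn_annM hproj hU, _, hrange, key⟩

/-- If `M` has an essential direct sum of submodules `U i`, then the annihilators of the `U i`
intersect in zero. -/
theorem IsSemiprimeModule.iInf_annM_eq_bot (hsemi : IsSemiprimeModule R M)
    (hproj : IsProjectiveInSigma R M) {ι : Type*} {U : ι → Submodule R M}
    (hind : iSupIndep U) (hess : IsEssentialSubmodule (⨆ i, U i)) :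
    ⨅ i, annM R M (U i) = ⊥ := by
  classical
  by_contra hA
  obtain ⟨f, x, hx, hfx⟩ := hsemi.exists_apply_ne_zero hproj (hess _ hA)
  have hx' : x ∈ annM R M ↥(⨆ i, U i) := by
    rw [Submodule.iSup_eq_range_dfinsupp_lsum]
    let e := LinearEquiv.ofInjective _ hind.dfinsupp_lsum_injective
    refine mem_annM.2 fun f ↦ e.symm.injective ?_
    rw [map_zero]
    refine DFinsupp.ext fun i ↦ ?_
    exact mem_annM.1 ((Submodule.mem_iInf _).1 hx.2 i)
      (DFinsupp.lapply i ∘ₗ e.symm.toLinearMap ∘ₗ f)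
  exact hfx (mem_annM.1 (annM_le_of_injective (Submodule.inclusion inf_le_left)
    (Submodule.inclusion_injective _) hx') f)

theorem IsPrimeIn.exists_le_of_finsetInf_le {Q : Submodule R M} (hQ : IsPrimeIn Q) {ι : Type*}
    (s : Finset ι) (A : ι → Submodule R M) (hA : ∀ i, (A i).IsFullyInvariant)
    (h : s.inf A ≤ Q) : ∃ i ∈ s, A i ≤ Q := by
  classical
  induction s using Finset.induction_on with
  | empty => exact absurd (top_le_iff.1 (by simpa using h)) hQ.1
  | insert i s _ ih =>
    have hs : (s.inf A).IsFullyInvariant := by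
      intro g x hx
      simp only [Submodule.mem_comap, Submodule.mem_finsetInf] at hx ⊢
      exact fun i hi ↦ hA i g (hx i hi)
    rw [Finset.inf_insert] at h
    rcases hQ.2.2 _ _ (hA i) hs (prodM_le_iff.2 fun f x hx ↦
      h ⟨hA i ((s.inf A).subtype ∘ₗ f) hx, (f x).2⟩) with h | h
    · exact ⟨i, Finset.mem_insert_self i s, h⟩
    · obtain ⟨j, hj, hjQ⟩ := ih h
      exact ⟨j, Finset.mem_insert_of_mem hj, hjQ⟩

/-- The minimal primes are among the annihilators of the members of any essential finite direct
sum of uniform submodules: these annihilators are minimal primes and intersect in zero. -/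
theorem IsSemiprimeModule.exists_eq_annM (hsemi : IsSemiprimeModule R M)
    (hproj : IsProjectiveInSigma R M) {ι : Type*} [Finite ι] {U : ι → Submodule R M}
    (hU : ∀ i, IsUniformModule R (U i)) (hind : iSupIndep U)
    (hess : IsEssentialSubmodule (⨆ i, U i)) {Q : Submodule R M} (hQ : IsMinimalPrimeIn Q) :
    ∃ i, annM R M (U i) = Q := by
  cases nonempty_fintype ι
  obtain ⟨i, -, hi⟩ := hQ.prop.exists_le_of_finsetInf_le Finset.univ (fun i ↦ annM R M (U i))
    (fun i ↦ isFullyInvariant_annM _) (by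
      rw [Finset.inf_univ_eq_iInf, hsemi.iInf_annM_eq_bot hproj hind hess]
      exact bot_le)
  exact ⟨i, le_antisymm hi (hQ.le_of_le (hsemi.isPrimeIn_annM hproj (hU i)) hi)⟩

/-! ### Uniform submodules under the ascending chain condition on annihilators -/

/-- Among the maps `f : M → V` that do not vanish on `V`, take one with maximal kernel, and
`g : M → f(V)` that does not vanish on `f(V)`. The maps `g ∘ f` and `f` then have the same kernel,
so `g` is injective on `f(V)`, hence on the uniform module `V`. -/
theorem IsSemiprimeModule.exists_injective_on (hsemi : IsSemiprimeModule R M)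
    (hproj : IsProjectiveInSigma R M) (hacc : HasACCOnAnnihilators R M) {V : Submodule R M}
    (hV : IsUniformModule R V) : ∃ g : M →ₗ[R] V, ∀ x ∈ V, g x = 0 → x = 0 := by
  have hV0 : V ≠ ⊥ := Submodule.nontrivial_iff_ne_bot.1 hV.1
  have hker : ∀ f : M →ₗ[R] V, LinearMap.ker f ∈ annihilatorSet R M := by
    refine fun f ↦ ⟨{V.subtype ∘ₗ f}, ?_⟩
    simp [LinearMap.ker_comp]
  let S : Set (annihilatorSet R M) :=
    {A | ∃ f : M →ₗ[R] V, (∃ x ∈ V, f x ≠ 0) ∧ A.1 = LinearMap.ker f}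
  have hacc' : WellFoundedGT (annihilatorSet R M) := hacc
  obtain ⟨f₀, hf₀⟩ := hsemi.exists_apply_ne_zero hproj hV0
  obtain ⟨⟨_, hA⟩, ⟨f, ⟨x, hx, hfx⟩, rfl⟩, hmax⟩ := hacc'.wf.has_min S ⟨⟨_, hker f₀⟩, f₀, hf₀, rfl⟩
  let W : Submodule R M := V.map (V.subtype ∘ₗ f)
  have hWV : W ≤ V := by
    rintro _ ⟨y, -, rfl⟩
    exact (f y).2
  have hW0 : W ≠ ⊥ := (Submodule.ne_bot_iff _).2
    ⟨f x, ⟨x, hx, rfl⟩, fun h ↦ hfx (Subtype.ext h)⟩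
  obtain ⟨g, w, hw, hgw⟩ := hsemi.exists_apply_ne_zero hproj hW0
  let g' : M →ₗ[R] V := Submodule.inclusion hWV ∘ₗ g
  have hg' : ∀ y, g' y = 0 → g y = 0 := fun y hy ↦ Submodule.inclusion_injective hWV (by
    rw [map_zero]; exact hy)
  have hinjW : LinearMap.ker g' ⊓ W ⊓ V = ⊥ := by
    rw [eq_bot_iff]
    rintro _ ⟨⟨hy, y, -, rfl⟩, -⟩
    let k : M →ₗ[R] V := g' ∘ₗ V.subtype ∘ₗ f
    have hk : LinearMap.ker f ≤ LinearMap.ker k := by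
      intro z hz
      have hz : f z = 0 := hz
      simp [k, hz]
    have hkS : (⟨_, hker k⟩ : annihilatorSet R M) ∈ S := by
      obtain ⟨z, hz, rfl⟩ := hw
      exact ⟨k, ⟨z, hz, fun h ↦ hgw (hg' _ h)⟩, rfl⟩
    have heq : LinearMap.ker k ≤ LinearMap.ker f := by
      by_contra hnle
      exact hmax _ hkS (lt_of_le_not_ge (a := (⟨_, hker f⟩ : annihilatorSet R M)) hk hnle)
    have : f y = 0 := heq hy
    simp [this]
  refine ⟨g', fun y hy hgy ↦ ?_⟩
  have hWV' : W ⊓ V ≠ ⊥ := by rwa [inf_eq_left.2 hWV]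
  by_contra hy0
  exact hV.inf_inf_ne_bot ((Submodule.ne_bot_iff _).2 ⟨y, ⟨hgy, hy⟩, hy0⟩) hWV' hinjW

/-- Uniform submodules with the same annihilator have isomorphic nonzero submodules: if
`f : M → V` does not vanish on `U`, then a map `M → f(U)` that is injective on `f(U)` lifts along
`f : U → f(U)` to a map `M → U` that is injective on `f(U) ⊆ V`. -/
theorem IsSemiprimeModule.exists_injective_of_annM_eq (hsemi : IsSemiprimeModule R M)
    (hproj : IsProjectiveInSigma R M) (hacc : HasACCOnAnnihilators R M) {U V : Submodule R M}
    (hU : IsUniformModule R U) (hV : IsUniformModule R V) (hUV : annM R M U = annM R M V) :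
    ∃ W ≤ V, W ≠ ⊥ ∧ ∃ h : W →ₗ[R] U, Function.Injective h := by
  have hU0 : U ≠ ⊥ := Submodule.nontrivial_iff_ne_bot.1 hU.1
  obtain ⟨f, x, hx, hfx⟩ : ∃ f : M →ₗ[R] V, ∃ x ∈ U, f x ≠ 0 := by
    by_contra! hcon
    refine hU0 (hsemi.eq_bot_of_le_annM hproj ?_)
    rw [hUV]
    exact fun x hx ↦ mem_annM.2 fun f ↦ hcon f x hx
  let p : U →ₗ[R] M := V.subtype ∘ₗ f ∘ₗ U.subtype
  let W : Submodule R M := LinearMap.range p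
  have hWV : W ≤ V := by
    rintro _ ⟨y, rfl⟩
    exact (f y).2
  have hW0 : W ≠ ⊥ := (Submodule.ne_bot_iff _).2
    ⟨f x, ⟨⟨x, hx⟩, rfl⟩, fun h ↦ hfx (Subtype.ext h)⟩
  have hW : IsUniformModule R W := by
    refine ⟨Submodule.nontrivial_iff_ne_bot.2 hW0, fun K L hK hL h ↦ ?_⟩
    have inj := Submodule.map_injective_of_injective (Submodule.inclusion_injective hWV)
    refine hV.2 (K.map (Submodule.inclusion hWV)) (L.map (Submodule.inclusion hWV))
      (fun h ↦ hK (inj (by simpa using h))) (fun h ↦ hL (inj (by simpa using h))) ?_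
    rw [← Submodule.map_inf _ (Submodule.inclusion_injective hWV), h, Submodule.map_bot]
  obtain ⟨g, hg⟩ := hsemi.exists_injective_on hproj hacc hW
  obtain ⟨h, rfl⟩ := hproj U W (inSigma_submodule U) (inSigma_submodule W) p.rangeRestrict
    p.surjective_rangeRestrict g
  refine ⟨W, hWV, hW0, h ∘ₗ W.subtype, ?_⟩
  rw [injective_iff_map_eq_zero]
  intro y hy
  refine Subtype.ext (hg y y.2 ?_)
  have hy : h y = 0 := hy
  rw [LinearMap.comp_apply, hy, map_zero]

end Semiprime

/-! ### The decomposition of the injective hull -/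

theorem IsEssentialSubmodule.map {R : Type u} [Ring R] {X Y : Type v} [AddCommGroup X]
    [Module R X] [AddCommGroup Y] [Module R Y] {N : Submodule R X} (hN : IsEssentialSubmodule N)
    {j : X →ₗ[R] Y} (hj : Function.Injective j)
    (hess : IsEssentialSubmodule (LinearMap.range j)) : IsEssentialSubmodule (N.map j) := by
  intro L hL
  obtain ⟨_, ⟨⟨x, rfl⟩, hxL⟩, hx0⟩ := (Submodule.ne_bot_iff _).1 (hess L hL)
  have hcomap : L.comap j ≠ ⊥ :=
    (Submodule.ne_bot_iff _).2 ⟨x, hxL, fun h ↦ hx0 (by rw [h, map_zero])⟩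
  obtain ⟨y, ⟨hyN, hyL⟩, hy0⟩ := (Submodule.ne_bot_iff _).1 (hN _ hcomap)
  exact (Submodule.ne_bot_iff _).2
    ⟨j y, ⟨⟨y, hyN, rfl⟩, hyL⟩, fun h ↦ hy0 (hj (by rw [h, map_zero]))⟩

/-- A finite product indexed by `ι` whose factors depend, up to isomorphism, only on the image
under a surjection `c : ι → Fin n` is a product of powers. -/
theorem exists_nonempty_linearEquiv_pi_powers {R : Type u} [Ring R] {ι : Type*} [Finite ι] {n : ℕ}
    (c : ι → Fin n) (hc : Function.Surjective c) (F : ι → Type v) [∀ i, AddCommGroup (F i)]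
    [∀ i, Module R (F i)] (E : Fin n → Type v) [∀ i, AddCommGroup (E i)] [∀ i, Module R (E i)]
    (e : ∀ i, Nonempty (F i ≃ₗ[R] E (c i))) :
    ∃ k : Fin n → ℕ, (∀ i, 0 < k i) ∧
      Nonempty ((∀ i, F i) ≃ₗ[R] ((i : Fin n) → Fin (k i) → E i)) := by
  classical
  cases nonempty_fintype ι
  let σ : ∀ a, {i // c i = a} ≃ Fin (Fintype.card {i // c i = a}) := fun a ↦ Fintype.equivFin _
  refine ⟨fun a ↦ Fintype.card {i // c i = a}, fun a ↦ ?_, ⟨?_⟩⟩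
  · obtain ⟨i, hi⟩ := hc a
    exact Fintype.card_pos_iff.2 ⟨⟨i, hi⟩⟩
  · let τ : ι ≃ Σ a, Fin (Fintype.card {i // c i = a}) :=
      (Equiv.sigmaFiberEquiv c).symm.trans (Equiv.sigmaCongrRight σ)
    have hτ : ∀ p, c (τ.symm p) = p.1 := fun p ↦ ((σ p.1).symm p.2).2
    have e' : ∀ p, Nonempty (F (τ.symm p) ≃ₗ[R] E p.1) := fun p ↦ hτ p ▸ e (τ.symm p)
    exact (LinearEquiv.piCongrLeft' R F τ).trans
      ((LinearEquiv.piCongrRight fun p ↦ (e' p).some).trans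
        (LinearEquiv.piCurry R fun a (_ : Fin (Fintype.card {i // c i = a})) ↦ E a))

theorem theorem2p20 {R : Type u} [Ring R] {M : Type v} [AddCommGroup M] [Module R M]
    (hproj : IsProjectiveInSigma R M) (hsemi : IsSemiprimeModule R M) (hGoldie : IsGoldieModule R M)
    {Mhat : Type v} [AddCommGroup Mhat] [Module R Mhat]
    (j : M →ₗ[R] Mhat) (hj : IsInjectiveHullInSigma M j) :
    {P : Submodule R M | IsMinimalPrimeIn P}.Finite ∧
    ∀ (n : ℕ) (P : Fin n → Submodule R M), Function.Injective P →
      Set.range P = {P : Submodule R M | IsMinimalPrimeIn P} →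
      ∃ (E : Fin n → Type v) (_ : ∀ i, AddCommGroup (E i)) (_ : ∀ i, Module R (E i))
        (k : Fin n → ℕ),
        (∀ i, IsUniformModule R (E i) ∧ IsInjectiveInSigma R M (E i) ∧
          assM R M (E i) = {P i} ∧ 0 < k i) ∧
        Nonempty (Mhat ≃ₗ[R] ((i : Fin n) → Fin (k i) → E i)) := by
  obtain ⟨hacc, hdim⟩ := hGoldie
  obtain ⟨hjinj, hjess, hQ⟩ := hj
  obtain ⟨s, hsfin, hsU, hind, hess⟩ := hdim.exists_iSupIndep_isUniformModule
  have : Finite s := hsfin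
  have hU : ∀ U : s, IsUniformModule R U.1 := fun U ↦ hsU U.1 U.2
  refine ⟨(Set.finite_range fun U : s ↦ annM R M U.1).subset fun Q hQ ↦
    hsemi.exists_eq_annM hproj hU hind hess hQ, fun n P hPinj hP ↦ ?_⟩
  -- The summands of `Mhat` are essential extensions `F U` of the members `U` of the family `s`.
  choose F hUF hF p hp using fun U : s ↦ hQ.exists_essential_retract (U.1.map j)
  have hFinj : ∀ U, IsInjectiveInSigma R M (F U) := fun U ↦ hQ.of_retract (p U) (hp U)
  obtain ⟨Ψ⟩ := hQ.nonempty_linearEquiv_pi (LinearMap.iSupIndep_map j hjinj hind)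
    (by rw [← Submodule.map_iSup]; exact hess.map hjinj hjess)
    hUF hF hFinj
  let u : ∀ U : s, U.1 →ₗ[R] F U := fun U ↦
    (j ∘ₗ U.1.subtype).codRestrict (F U) fun x ↦ hUF U ⟨x, x.2, rfl⟩
  have hu : ∀ U, Function.Injective (u U) := fun U x y h ↦
    Subtype.ext (hjinj (congrArg Subtype.val h))
  have hFu : ∀ U, IsUniformModule R (F U) := by
    refine fun U ↦ (hU U).of_isEssentialSubmodule_range (hu U) (isEssentialSubmodule_iff.2 ?_)
    intro x hx
    obtain ⟨r, hr0, y, hy, hry⟩ := hF U x x.2 fun h ↦ hx (Subtype.ext h)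
    exact ⟨r, fun h ↦ hr0 (congrArg Subtype.val h), ⟨y, hy⟩, Subtype.ext hry⟩
  have hiso : ∀ U V : s, annM R M U.1 = annM R M V.1 → Nonempty (F U ≃ₗ[R] F V) := by
    intro U V hUV
    obtain ⟨W, hWV, hW0, h, hh⟩ := hsemi.exists_injective_of_annM_eq hproj hacc (hU U) (hU V) hUV
    have := Submodule.nontrivial_iff_ne_bot.2 hW0
    exact (hFinj V).nonempty_linearEquiv_of_isUniformModule (hFinj U) (hFu V) (hFu U)
      (u V ∘ₗ Submodule.inclusion hWV) ((hu V).comp (Submodule.inclusion_injective hWV))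
      (u U ∘ₗ h) ((hu U).comp hh)
  have hc : ∀ U : s, ∃ i, P i = annM R M U.1 := fun U ↦ by
    have : annM R M U.1 ∈ Set.range P := hP ▸ hsemi.isMinimalPrimeIn_annM hproj (hU U)
    exact this
  choose c hc using hc
  have hrep : ∀ i, ∃ U : s, annM R M U.1 = P i := fun i ↦
    hsemi.exists_eq_annM hproj hU hind hess (hP.subset (Set.mem_range_self i))
  choose T hT using hrep
  obtain ⟨k, hk, ⟨Θ⟩⟩ := exists_nonempty_linearEquiv_pi_powers c
    (fun i ↦ ⟨T i, hPinj ((hc (T i)).trans (hT i))⟩) (fun U ↦ F U) (fun i ↦ F (T i))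
    (fun U ↦ hiso U (T (c U)) ((hc U).symm.trans (hT (c U)).symm))
  refine ⟨fun i ↦ F (T i), fun i ↦ inferInstance, fun i ↦ inferInstance, k, fun i ↦
    ⟨hFu _, hFinj _, ?_, hk i⟩, ⟨Ψ.trans Θ⟩⟩
  rw [← hT i]
  exact hsemi.assM_eq_singleton hproj (hU (T i)) (hFu (T i)) (u (T i)) (hu (T i))
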